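/- Conventions. Write $\widehat f(\omega)=\int_{\mathbb R}f(x)e^{-2\pi i x\omega}\,dx$ for $f\in L^1(\mathbb R)$, extended to $L^2(\mathbb R)$ in the usual way, $(f\ast g)(y)=\int_{\mathbb R}f(x)g(y-x)\,dx$, and $(x)_+=\max\{0,x\}$. All functions are complex-valued. For $s>0$, $H^s(\mathbb R)$ is the set of $f\in L^2(\mathbb R)$ with $\int_{\mathbb R}(1+|\omega|^2)^s|\widehat f(\omega)|^2\,d\omega<\infty$. For a family of filters $\{g_\lambda\}_{\lambda\in\Lambda}\subseteq L^1(\mathbb R)\cap L^2(\mathbb R)$ with $\Lambda=\mathbb Z\setminus\{0\}$, used in every layer, put $U[\lambda]f=|f\ast g_\lambda|$, $U[q]f=U[\lambda_N]\cdots U[\lambda_1]f$ for $q=(\lambda_1,\dots,\lambda_N)\in\Lambda^N$, and $$W_N(f)=\sum_{q\in\Lambda^N}\|U[q]f\|_2^2 ,\qquad f\in L^2(\mathbb R).$$ We write $W_N(f)=\mathcal O(G(N))$ if there are $C>0$ and $N_0\in\mathbb N$ with $W_N(f)\le C\,G(N)$ for all $N\ge N_0$. Theorem. Let $l>1$ and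 $\widehat{r_l}(\omega)=(1-|\omega|)_+^l$ for $\omega\in\mathbb R$. (i) (Wavelets.) Let $\psi,\phi\in L^1(\mathbb R)\cap L^2(\mathbb R)$ satisfy $\operatorname{supp}(\widehat\psi)\subseteq[1/2,2]$ and $$|\widehat\phi(\omega)|^2+\sum_{j=1}^\infty|\widehat\psi(2^{-j}\omega)|^2=1\quad\text{for a.e. }\omega\ge0 .$$ Let $g_j(x)=2^j\psi(2^jx)$ for $j\ge1$ and $g_j(x)=2^{|j|}\psi(-2^{|j|}x)$ for $j\le-1$, and let $W_N$ be formed with the filters $\{g_j\}_{j\in\mathbb Z\setminus\{0\}}$. Then, for all $f\in L^2(\mathbb R)$ and all $N\ge1$, $$W_N(f)\le\int_{\mathbb R}|\widehat f(\omega)|^2\Big(1-\Big|\widehat{r_l}\Big(\frac{\omega}{(5/3)^{N-1}}\Big)\Big|^2\Big)\,d\omega .$$ Moreover, for every $s>0$ and every $f\in H^s(\mathbb R)$, $W_N(f)=\mathcal O\big((5/3)^{-\gamma N}\big)$ with $\gamma=\min\{1,2s\}$. (ii) (Weyl–Heisenberg filters.) Let $R\in\mathbb R$ and let $g,\phi\in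 L^1(\mathbb R)\cap L^2(\mathbb R)$ satisfy $\operatorname{supp}(\widehat g)\subseteq[-R,R]$, $\widehat g(-\omega)=\widehat g(\omega)$ for all $\omega\in\mathbb R$, and $$|\widehat\phi(\omega)|^2+\sum_{k=1}^\infty|\widehat g(\omega-R(k+1))|^2=1\quad\text{for a.e. }\omega\ge0$$ (these conditions force $R>0$). Let $g_k(x)=e^{2\pi i(k+1)Rx}g(x)$ for $k\ge1$ and $g_k(x)=e^{-2\pi i(|k|+1)Rx}g(x)$ for $k\le-1$, and let $W_N$ be formed with the filters $\{g_k\}_{k\in\mathbb Z\setminus\{0\}}$. Then, for all $f\in L^2(\mathbb R)$ and all $N\ge1$, $$W_N(f)\le\int_{\mathbb R}|\widehat f(\omega)|^2\Big(1-\Big|\widehat{r_l}\Big(\frac{\omega}{(3/2)^{N-1}R}\Big)\Big|^2\Big)\,d\omega .$$ Moreover, for every $s>0$ and every $f\in H^s(\mathbb R)$, $W_N(f)=\mathcal O\big((3/2)^{-\gamma N}\big)$ with $\gamma=\min\{1,2s\}$. -/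

import Mathlib

open MeasureTheory
open scoped FourierTransform ENNReal

noncomputable section

namespace Scattering

/-- The function `ω ↦ (1 - |ω|)_+ ^ l` on the real line. -/
def rHat (l ω : ℝ) : ℝ := (max 0 (1 - |ω|)) ^ l

/-- One layer of the network for the filter `g`: `x ↦ |(f ∗ g)(x)|`, where
`(f ∗ g)(x) = ∫ f(t) g(x - t) dt`. -/
def layer (g f : ℝ → ℂ) : ℝ → ℂ :=
  fun x => ((‖convolution f g (ContinuousLinearMap.mul ℂ ℂ) volume x‖ : ℝ) : ℂ)

/-- The feature map `U[q] f = U[q_N] ⋯ U[q_2] U[q_1] f` of a path `q = (q_1, …, q_N)`, where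
`U[i] f = |f ∗ g_i|`, for a network with the same filters `g` in every layer; the empty path
gives `f`. -/
def featureMap {ι : Type} (g : ι → ℝ → ℂ) : (N : ℕ) → (Fin N → ι) → (ℝ → ℂ) → (ℝ → ℂ)
  | 0, _, f => f
  | N + 1, q, f => featureMap g N (fun i => q i.succ) (layer (g (q 0)) f)

/-- The energy `W_N(f) = ∑_q ‖U[q] f‖₂²`, the sum being over all paths `q` of length `N`. -/
def energy {ι : Type} (g : ι → ℝ → ℂ) (N : ℕ) (f : ℝ → ℂ) : ℝ≥0∞ :=
  ∑' q : Fin N → ι, eLpNorm (featureMap g N q f) 2 volume ^ 2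

/-- The wavelet filters: `g_j(x) = 2^j ψ(2^j x)` for `j ≥ 1` and
`g_j(x) = 2^|j| ψ(-2^|j| x)` for `j ≤ -1`. -/
def waveletFilter (ψ : ℝ → ℂ) (j : {j : ℤ // j ≠ 0}) : ℝ → ℂ := fun x =>
  if 0 < j.1 then (2 : ℂ) ^ j.1.natAbs * ψ ((2 : ℝ) ^ j.1.natAbs * x)
  else (2 : ℂ) ^ j.1.natAbs * ψ (-((2 : ℝ) ^ j.1.natAbs * x))

/-- The Weyl-Heisenberg filters: `g_k(x) = exp(2πi(k+1)Rx) g(x)` for `k ≥ 1` and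
`g_k(x) = exp(-2πi(|k|+1)Rx) g(x)` for `k ≤ -1`. -/
def weylHeisenbergFilter (R : ℝ) (g : ℝ → ℂ) (k : {k : ℤ // k ≠ 0}) : ℝ → ℂ := fun x =>
  if 0 < k.1 then
    Complex.exp (2 * Real.pi * Complex.I * ((k.1.natAbs : ℂ) + 1) * R * x) * g x
  else
    Complex.exp (-(2 * Real.pi * Complex.I * ((k.1.natAbs : ℂ) + 1) * R * x)) * g x

/-- Membership of `f ∈ L²(ℝ)` in the Sobolev space `H^s(ℝ)`:
`∫ (1 + |ω|²)^s |f̂(ω)|² dω < ∞`, with `f̂` the Fourier transform on `L²(ℝ)`. -/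
def MemSobolevSpace (s : ℝ) (f : Lp ℂ 2 (volume : Measure ℝ)) : Prop :=
  ∫⁻ ω : ℝ, ENNReal.ofReal ((1 + |ω| ^ 2) ^ s * ‖(𝓕 f : Lp ℂ 2 (volume : Measure ℝ)) ω‖ ^ 2) < ∞

/-- The integral `∫ |f̂(ω)|² (1 - |r̂_l(ω / a)|²) dω` (its integrand is nonnegative when
`0 ≤ l`). -/
def highPassEnergy (l a : ℝ) (f : Lp ℂ 2 (volume : Measure ℝ)) : ℝ≥0∞ :=
  ∫⁻ ω : ℝ, ENNReal.ofReal
    (‖(𝓕 f : Lp ℂ 2 (volume : Measure ℝ)) ω‖ ^ 2 * (1 - |rHat l (ω / a)| ^ 2))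

end Scattering

end

namespace Scattering

open scoped SchwartzMap ComplexInnerProductSpace ComplexConjugate

/-! ### Fourier transform and convolution on L² -/

theorem continuous_fourier {f : ℝ → ℂ} (hf : Integrable f) : Continuous (𝓕 f) :=
  VectorFourier.fourierIntegral_continuous Real.continuous_fourierChar continuous_inner hf

theorem norm_fourier_le {f : ℝ → ℂ} (ω : ℝ) : ‖𝓕 f ω‖ ≤ ∫ x, ‖f x‖ :=
  VectorFourier.norm_fourierIntegral_le_integral_norm _ _ _ f ω

theorem integral_fourier_smul_eq_flip {f g : ℝ → ℂ} (hf : Integrable f) (hg : Integrable g) :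
    ∫ x, 𝓕 f x • g x = ∫ x, f x • 𝓕 g x := by
  have := VectorFourier.integral_fourierIntegral_smul_eq_flip (L := innerₗ ℝ)
    Real.continuous_fourierChar continuous_inner hf hg (μ := volume) (ν := volume)
  rw [flip_innerₗ] at this
  exact this

/-- Both sides are tested against smooth compactly supported functions: the L² transform is moved
onto the test function as a tempered distribution, the integral transform by Fubini. -/
theorem fourier_toLp_ae_eq {f : ℝ → ℂ} (h1 : Integrable f) (h2 : MemLp f 2 volume) :
    (𝓕 (h2.toLp f) : Lp ℂ 2 (volume : Measure ℝ)) =ᵐ[volume] 𝓕 f := by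
  refine ae_eq_of_integral_contDiff_smul_eq
    ((Lp.memLp _).locallyIntegrable (by norm_num))
    (continuous_fourier h1).locallyIntegrable fun g hg hgc => ?_
  have hg₁ : HasCompactSupport (Complex.ofRealCLM ∘ g) := hgc.comp_left rfl
  let G : 𝓢(ℝ, ℂ) := hg₁.toSchwartzMap (by fun_prop)
  have hG : ∀ x, G x = (g x : ℂ) := fun x => rfl
  have e1 : (𝓕 ((h2.toLp f : Lp ℂ 2 (volume : Measure ℝ)) : 𝓢'(ℝ, ℂ))) G
      = ∫ x, g x • (𝓕 (h2.toLp f) : Lp ℂ 2 (volume : Measure ℝ)) x := by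
    rw [Lp.fourier_toTemperedDistribution_eq, Lp.toTemperedDistribution_apply]
    simp [hG]
  rw [← e1, TemperedDistribution.fourier_apply, Lp.toTemperedDistribution_apply]
  have e2 : ∫ x, (𝓕 G) x • (h2.toLp f) x = ∫ x, 𝓕 (G : ℝ → ℂ) x • f x := by
    refine integral_congr_ae ?_
    filter_upwards [h2.coeFn_toLp] with x hx
    rw [hx, SchwartzMap.fourier_coe]
  rw [e2, integral_fourier_smul_eq_flip G.integrable h1]
  simp [hG]

theorem fourierInv_toLp_ae_eq {f : ℝ → ℂ} (h1 : Integrable f) (h2 : MemLp f 2 volume) :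
    (𝓕⁻ (h2.toLp f) : Lp ℂ 2 (volume : Measure ℝ)) =ᵐ[volume] 𝓕⁻ f := by
  have hcont : Continuous (𝓕⁻ f) := by
    rw [Real.fourierInv_eq_fourier_comp_neg]
    exact continuous_fourier h1.comp_neg
  refine ae_eq_of_integral_contDiff_smul_eq
    ((Lp.memLp _).locallyIntegrable (by norm_num))
    hcont.locallyIntegrable fun g hg hgc => ?_
  have hg₁ : HasCompactSupport (Complex.ofRealCLM ∘ g) := hgc.comp_left rfl
  let G : 𝓢(ℝ, ℂ) := hg₁.toSchwartzMap (by fun_prop)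
  have hG : ∀ x, G x = (g x : ℂ) := fun x => rfl
  have e1 : (𝓕⁻ ((h2.toLp f : Lp ℂ 2 (volume : Measure ℝ)) : 𝓢'(ℝ, ℂ))) G
      = ∫ x, g x • (𝓕⁻ (h2.toLp f) : Lp ℂ 2 (volume : Measure ℝ)) x := by
    rw [Lp.fourierInv_toTemperedDistribution_eq, Lp.toTemperedDistribution_apply]
    simp [hG]
  rw [← e1, TemperedDistribution.fourierInv_apply, Lp.toTemperedDistribution_apply]
  have e2 : ∫ x, (𝓕⁻ G) x • (h2.toLp f) x = ∫ x, 𝓕 (G : ℝ → ℂ) x • f (-x) := by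
    rw [← integral_neg_eq_self]
    refine integral_congr_ae ?_
    filter_upwards [(Measure.measurePreserving_neg (volume : Measure ℝ)).quasiMeasurePreserving.ae
      h2.coeFn_toLp] with x hx
    rw [hx, SchwartzMap.fourierInv_coe, Real.fourierInv_eq_fourier_neg, neg_neg]
  rw [e2, integral_fourier_smul_eq_flip G.integrable h1.comp_neg,
    Real.fourierInv_eq_fourier_comp_neg]
  simp [hG]

theorem memLp_fourier {g : ℝ → ℂ} (h1 : Integrable g) (h2 : MemLp g 2 volume) :
    MemLp (𝓕 g) 2 volume :=
  (memLp_congr_ae (fourier_toLp_ae_eq h1 h2)).1 (Lp.memLp _)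

theorem memLp_fourier_mul {g : ℝ → ℂ} (h1 : Integrable g) (F : Lp ℂ 2 (volume : Measure ℝ)) :
    MemLp (fun ω => 𝓕 g ω * F ω) 2 volume := by
  refine (Lp.memLp F).of_le_mul (c := ∫ x, ‖g x‖)
    ((continuous_fourier h1).aestronglyMeasurable.mul (Lp.aestronglyMeasurable F)) ?_
  filter_upwards with ω
  rw [norm_mul]
  gcongr
  exact norm_fourier_le ω

theorem integrable_fourier_mul {g : ℝ → ℂ} (h1 : Integrable g) (h2 : MemLp g 2 volume)
    (F : Lp ℂ 2 (volume : Measure ℝ)) : Integrable (fun ω => 𝓕 g ω * F ω) :=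
  (memLp_fourier h1 h2).integrable_mul (Lp.memLp F)

theorem fourier_conj_reflect_translate {g : ℝ → ℂ} (x ω : ℝ) :
    𝓕 (fun t => conj (g (x - t))) ω = conj (Real.fourierChar (x * ω) * 𝓕 g ω) := by
  rw [Real.fourier_real_eq, Real.fourier_real_eq, ← integral_const_mul, ← integral_conj,
    ← integral_sub_left_eq_self _ volume x]
  refine integral_congr_ae (Filter.Eventually.of_forall fun t => ?_)
  simp only [Circle.smul_def, smul_eq_mul, map_mul, sub_sub_cancel]
  rw [← mul_assoc]
  congr 1
  rw [← Circle.coe_inv_eq_conj, ← Circle.coe_inv_eq_conj, ← Circle.coe_mul, ← AddChar.map_neg_eq_inv,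
    ← AddChar.map_neg_eq_inv, ← AddChar.map_add_eq_mul]
  congr 2
  ring

/-- For fixed `x` the convolution is the inner product of `t ↦ conj (g (x - t))` with `f`, so
Parseval gives the identity at every point, not just almost everywhere. -/
theorem convolution_eq_fourierInv {g : ℝ → ℂ} (h1 : Integrable g) (h2 : MemLp g 2 volume)
    (f : Lp ℂ 2 (volume : Measure ℝ)) :
    convolution f g (ContinuousLinearMap.mul ℂ ℂ) volume
      = 𝓕⁻ (fun ω => 𝓕 g ω * (𝓕 f : Lp ℂ 2 (volume : Measure ℝ)) ω) := by
  ext x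
  have u1 : Integrable (fun t => conj (g (x - t))) :=
    (Complex.conjLIE.integrable_comp_iff).2 (h1.comp_sub_left x)
  have u2 : MemLp (fun t => conj (g (x - t))) 2 volume :=
    (h2.comp_measurePreserving (Measure.measurePreserving_sub_left volume x)).star
  have key := Lp.inner_fourier_eq (u2.toLp _) f
  rw [L2.inner_def, L2.inner_def] at key
  calc convolution f g (ContinuousLinearMap.mul ℂ ℂ) volume x
      = ∫ t, ⟪(u2.toLp _) t, f t⟫ := by
        rw [convolution]
        refine integral_congr_ae ?_
        filter_upwards [u2.coeFn_toLp] with t ht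
        rw [ht]; simp
    _ = _ := key.symm
    _ = _ := by
        rw [Real.fourierInv_eq]
        refine integral_congr_ae ?_
        filter_upwards [fourier_toLp_ae_eq u1 u2] with ω hω
        rw [hω, fourier_conj_reflect_translate]
        simp [Circle.smul_def, mul_comm, mul_left_comm]

theorem memLp_convolution {g : ℝ → ℂ} (h1 : Integrable g) (h2 : MemLp g 2 volume)
    (f : Lp ℂ 2 (volume : Measure ℝ)) :
    MemLp (convolution f g (ContinuousLinearMap.mul ℂ ℂ) volume) 2 volume := by
  rw [convolution_eq_fourierInv h1 h2]
  exact (memLp_congr_ae (fourierInv_toLp_ae_eq (integrable_fourier_mul h1 h2 _)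
    (memLp_fourier_mul h1 _))).1 (Lp.memLp _)

theorem fourier_convolution_ae_eq {g : ℝ → ℂ} (h1 : Integrable g) (h2 : MemLp g 2 volume)
    (f : Lp ℂ 2 (volume : Measure ℝ)) :
    (𝓕 ((memLp_convolution h1 h2 f).toLp _) : Lp ℂ 2 (volume : Measure ℝ)) =ᵐ[volume]
      fun ω => 𝓕 g ω * (𝓕 f : Lp ℂ 2 (volume : Measure ℝ)) ω := by
  have e : (memLp_convolution h1 h2 f).toLp _
      = (𝓕⁻ ((memLp_fourier_mul h1 (𝓕 f)).toLp _) : Lp ℂ 2 (volume : Measure ℝ)) := by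
    refine Lp.ext ((memLp_convolution h1 h2 f).coeFn_toLp.trans ?_)
    rw [convolution_eq_fourierInv h1 h2]
    exact (fourierInv_toLp_ae_eq (integrable_fourier_mul h1 h2 _) (memLp_fourier_mul h1 _)).symm
  rw [e, FourierTransform.fourier_fourierInv_eq]
  exact (memLp_fourier_mul h1 _).coeFn_toLp

/-! ### Weighted spectral energy and the modulus -/

/-- Parseval turns a spectral weight into a quadratic form in physical space, where the effect of
the modulus is visible. -/
theorem integrable_normSq_fourier_mul_and_integral_eq {g : ℝ → ℂ} (h1 : Integrable g)
    (h2 : MemLp g 2 volume) {M : ℝ → ℝ} (hM : ∀ ω, 𝓕 g ω = M ω)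
    (F : Lp ℂ 2 (volume : Measure ℝ)) :
    Integrable (fun ω => ‖(𝓕 F : Lp ℂ 2 (volume : Measure ℝ)) ω‖ ^ 2 * M ω) ∧
    ∫ ω, ‖(𝓕 F : Lp ℂ 2 (volume : Measure ℝ)) ω‖ ^ 2 * M ω
      = (⟪F, (memLp_convolution h1 h2 F).toLp _⟫).re := by
  have hae : (fun ω => ⟪(𝓕 F : Lp ℂ 2 (volume : Measure ℝ)) ω,
      (𝓕 ((memLp_convolution h1 h2 F).toLp _) : Lp ℂ 2 (volume : Measure ℝ)) ω⟫)
      =ᵐ[volume] fun ω => ((‖(𝓕 F : Lp ℂ 2 (volume : Measure ℝ)) ω‖ ^ 2 * M ω : ℝ) : ℂ) := by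
    filter_upwards [fourier_convolution_ae_eq h1 h2 F] with ω hω
    rw [hω, hM, RCLike.inner_apply]
    push_cast
    rw [← Complex.mul_conj']
    ring
  have hint := (L2.integrable_inner (𝕜 := ℂ) (𝓕 F : Lp ℂ 2 (volume : Measure ℝ))
    (𝓕 ((memLp_convolution h1 h2 F).toLp _))).congr hae
  refine ⟨by simpa only [RCLike.ofReal_re, RCLike.re_to_complex, Complex.ofReal_re] using hint.re, ?_⟩
  rw [← Lp.inner_fourier_eq, L2.inner_def, integral_congr_ae hae, integral_complex_ofReal,
    Complex.ofReal_re]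

theorem lintegral_normSq_fourier_mul {g : ℝ → ℂ} (h1 : Integrable g)
    (h2 : MemLp g 2 volume) {M : ℝ → ℝ} (hM : ∀ ω, 𝓕 g ω = M ω) (hM0 : ∀ ω, 0 ≤ M ω)
    (F : Lp ℂ 2 (volume : Measure ℝ)) :
    ∫⁻ ω, ENNReal.ofReal (‖(𝓕 F : Lp ℂ 2 (volume : Measure ℝ)) ω‖ ^ 2 * M ω)
      = ENNReal.ofReal (⟪F, (memLp_convolution h1 h2 F).toLp _⟫).re := by
  obtain ⟨hi, he⟩ := integrable_normSq_fourier_mul_and_integral_eq h1 h2 hM F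
  rw [← he, ofReal_integral_eq_lintegral_ofReal hi]
  exact Filter.Eventually.of_forall fun ω => mul_nonneg (by positivity) (hM0 ω)

theorem fourier_modulate (g : ℝ → ℂ) (ν ω : ℝ) :
    𝓕 (fun x => Real.fourierChar (ν * x) • g x) ω = 𝓕 g (ω - ν) := by
  rw [Real.fourier_real_eq, Real.fourier_real_eq]
  refine integral_congr_ae (Filter.Eventually.of_forall fun t => ?_)
  simp only [Circle.smul_def, smul_eq_mul]
  rw [← mul_assoc, ← Circle.coe_mul, ← AddChar.map_add_eq_mul]
  congr 3
  ring

theorem aestronglyMeasurable_modulate {g : ℝ → ℂ} (hg : AEStronglyMeasurable g volume) (ν : ℝ) :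
    AEStronglyMeasurable (fun x => Real.fourierChar (ν * x) • g x) volume := by
  have h : Continuous fun x : ℝ => Real.fourierChar (ν * x) :=
    Real.continuous_fourierChar.comp (continuous_const.mul continuous_id)
  exact h.aestronglyMeasurable.smul hg

theorem memLp_modulate {g : ℝ → ℂ} {p : ℝ≥0∞} (hg : MemLp g p volume) (ν : ℝ) :
    MemLp (fun x => Real.fourierChar (ν * x) • g x) p volume :=
  hg.of_le (aestronglyMeasurable_modulate hg.1 ν) (Filter.Eventually.of_forall fun _ => (Circle.norm_smul _ _).le)

/-- Passing to the modulus can only increase the energy seen through a low-pass filter with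
nonnegative impulse response, even if the filter is shifted in frequency beforehand. -/
theorem lintegral_normSq_fourier_mul_le_of_abs {k : ℝ → ℝ} (hk : ∀ x, 0 ≤ k x)
    (h1 : Integrable (fun x => (k x : ℂ))) (h2 : MemLp (fun x => (k x : ℂ)) 2 volume)
    {K : ℝ → ℝ} (hK : ∀ ω, 𝓕 (fun x => (k x : ℂ)) ω = K ω) (hK0 : ∀ ω, 0 ≤ K ω) (ν : ℝ)
    {F A : Lp ℂ 2 (volume : Measure ℝ)} (hA : A =ᵐ[volume] fun x => ((‖F x‖ : ℝ) : ℂ)) :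
    ∫⁻ ω, ENNReal.ofReal (‖(𝓕 F : Lp ℂ 2 (volume : Measure ℝ)) ω‖ ^ 2 * K (ω - ν))
      ≤ ∫⁻ ω, ENNReal.ofReal (‖(𝓕 A : Lp ℂ 2 (volume : Measure ℝ)) ω‖ ^ 2 * K ω) := by
  have m1 := memLp_one_iff_integrable.1 (memLp_modulate (memLp_one_iff_integrable.2 h1) ν)
  have m2 := memLp_modulate h2 ν
  rw [lintegral_normSq_fourier_mul h1 h2 hK hK0,
    lintegral_normSq_fourier_mul m1 m2 (M := fun ω => K (ω - ν))
      (fun ω => by rw [fourier_modulate, hK]) (fun ω => hK0 _)]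
  refine ENNReal.ofReal_le_ofReal ?_
  rw [L2.inner_def, L2.inner_def]
  have i1 := L2.integrable_inner (𝕜 := ℂ) F ((memLp_convolution m1 m2 F).toLp _)
  have i2 := L2.integrable_inner (𝕜 := ℂ) A ((memLp_convolution h1 h2 A).toLp _)
  have r1 := integral_re i1
  have r2 := integral_re i2
  simp only [RCLike.re_to_complex] at r1 r2
  rw [← r1, ← r2]
  refine integral_mono_ae i1.re i2.re ?_
  filter_upwards [(memLp_convolution m1 m2 F).coeFn_toLp, (memLp_convolution h1 h2 A).coeFn_toLp,
    hA] with x e1 e2 e3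
  change Complex.re _ ≤ Complex.re _
  rw [e1, e2, e3, RCLike.inner_apply, RCLike.inner_apply]
  have hconv : convolution A (fun x => (k x : ℂ)) (ContinuousLinearMap.mul ℂ ℂ) volume x
      = ((∫ t, ‖F t‖ * k (x - t) : ℝ) : ℂ) := by
    rw [convolution, ← integral_complex_ofReal]
    refine integral_congr_ae ?_
    filter_upwards [hA] with t ht
    rw [ht]; simp
  rw [hconv, Complex.conj_ofReal, ← Complex.ofReal_mul, Complex.ofReal_re]
  -- The comparison is pointwise in `x`: since `k ≥ 0` and the modulating character has modulus one,
  -- `|F ∗ k_ν| ≤ |F| ∗ k`.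
  refine (Complex.re_le_norm _).trans ?_
  rw [norm_mul, RCLike.norm_conj]
  gcongr
  rw [convolution]
  refine (norm_integral_le_integral_norm _).trans (le_of_eq ?_)
  refine integral_congr_ae (Filter.Eventually.of_forall fun t => ?_)
  simp only [ContinuousLinearMap.mul_apply', norm_mul, Circle.norm_smul, Complex.norm_real,
    Real.norm_eq_abs, abs_of_nonneg (hk _)]

/-! ### Triangle functions and powers of them as positive superpositions -/

/-- The triangle function `ω ↦ (t - |ω|)_+`. -/
noncomputable def triangle (t ω : ℝ) : ℝ := max 0 (t - |ω|)

theorem triangle_nonneg (t ω : ℝ) : 0 ≤ triangle t ω := le_max_left _ _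

theorem continuous_triangle (t : ℝ) : Continuous (triangle t) := by
  unfold triangle; fun_prop

theorem hasCompactSupport_triangle (t : ℝ) : HasCompactSupport (triangle t) := by
  refine HasCompactSupport.intro (isCompact_Icc (a := -t) (b := t)) fun ω hω => ?_
  refine max_eq_left (sub_nonpos.2 ?_)
  by_contra! h
  exact hω (abs_le.1 h.le)

/-- The value is the length of the overlap of `[0, t]` with its translate by `ω`; for `t < 0` both
sides vanish. -/
theorem convolution_indicator_eq_triangle (t ω : ℝ) :
    convolution ((Set.Icc 0 t).indicator (1 : ℝ → ℂ))
      (fun x => conj ((Set.Icc 0 t).indicator (1 : ℝ → ℂ) (0 - x)))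
      (ContinuousLinearMap.mul ℂ ℂ) volume ω = triangle t ω := by
  have h : ∀ x, ContinuousLinearMap.mul ℂ ℂ ((Set.Icc 0 t).indicator (1 : ℝ → ℂ) x)
      (conj ((Set.Icc 0 t).indicator (1 : ℝ → ℂ) (0 - (ω - x))))
      = (Set.Icc (max 0 ω) (min t (t + ω))).indicator (1 : ℝ → ℂ) x := fun x => by
    by_cases hx : x ∈ Set.Icc (max 0 ω) (min t (t + ω))
    · have hx' := hx
      simp only [Set.mem_Icc, max_le_iff, le_min_iff] at hx'
      rw [Set.indicator_of_mem hx, Set.indicator_of_mem (by constructor <;> linarith),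
        Set.indicator_of_mem (by constructor <;> linarith)]
      simp
    · rw [Set.indicator_of_notMem hx]
      by_cases h1 : x ∈ Set.Icc 0 t
      · rw [Set.indicator_of_notMem (a := 0 - (ω - x))]
        · simp
        · intro h2
          exact hx ⟨max_le h1.1 (by linarith [h2.1]), le_min h1.2 (by linarith [h2.2])⟩
      · rw [Set.indicator_of_notMem h1]
        simp
  rw [convolution]
  simp_rw [h]
  rw [integral_indicator measurableSet_Icc]
  simp only [Pi.one_apply, integral_const, measureReal_restrict_apply_univ, Real.volume_real_Icc,
    Complex.real_smul, mul_one, triangle]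
  rw [max_comm]
  congr 2
  rcases le_total 0 ω with h0 | h0
  · rw [abs_of_nonneg h0, max_eq_right h0, min_eq_left (by linarith)]
  · rw [abs_of_nonpos h0, max_eq_left h0, min_eq_right (by linarith)]; ring

/-- The triangle is the autocorrelation of an interval indicator `b`, so its transform is `|b̂|² ≥
0`; Fourier inversion and evenness recover the triangle from this kernel. -/
theorem exists_nonneg_fourier_eq_triangle (t : ℝ) :
    ∃ k : ℝ → ℝ, (∀ x, 0 ≤ k x) ∧ Integrable (fun x => (k x : ℂ)) ∧
      MemLp (fun x => (k x : ℂ)) 2 volume ∧ ∀ ω, 𝓕 (fun x => (k x : ℂ)) ω = triangle t ω := by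
  set b : ℝ → ℂ := (Set.Icc 0 t).indicator 1 with hb
  have b1 : Integrable b := (integrable_indicator_iff measurableSet_Icc).2
    (integrableOn_const (by simp))
  have b2 : MemLp b 2 volume := memLp_indicator_const 2 measurableSet_Icc 1 (by simp)
  have b1' : Integrable (fun x => conj (b (0 - x))) :=
    (Complex.conjLIE.integrable_comp_iff).2 (b1.comp_sub_left 0)
  have hT : (fun ω => (triangle t ω : ℂ)) = convolution b (fun x => conj (b (0 - x)))
      (ContinuousLinearMap.mul ℂ ℂ) volume :=
    funext fun ω => (convolution_indicator_eq_triangle t ω).symm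
  have hcont : Continuous (fun ω => (triangle t ω : ℂ)) :=
    Complex.continuous_ofReal.comp (continuous_triangle t)
  have hcs : HasCompactSupport (fun ω => (triangle t ω : ℂ)) :=
    (hasCompactSupport_triangle t).comp_left Complex.ofReal_zero
  have hTk : 𝓕 (fun ω => (triangle t ω : ℂ)) = fun x => ((‖𝓕 b x‖ ^ 2 : ℝ) : ℂ) := by
    ext x
    rw [hT, Real.fourier_mul_convolution_eq b1 b1', fourier_conj_reflect_translate]
    push_cast
    rw [zero_mul, AddChar.map_zero_eq_one, Circle.coe_one, one_mul, Complex.mul_conj']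
  have hk1 : Integrable (fun x => ((‖𝓕 b x‖ ^ 2 : ℝ) : ℂ)) :=
    ((memLp_fourier b1 b2).integrable_norm_pow two_ne_zero).ofReal
  have hTi : Integrable (fun ω => (triangle t ω : ℂ)) := hcont.integrable_of_hasCompactSupport hcs
  refine ⟨fun x => ‖𝓕 b x‖ ^ 2, fun x => by positivity, hk1, ?_, fun ω => ?_⟩
  · rw [← hTk]
    exact memLp_fourier hTi (hcont.memLp_of_hasCompactSupport hcs)
  · have := congrFun (hcont.fourierInv_fourier_eq hTi (by rwa [hTk])) (-ω)
    rw [Real.fourierInv_eq_fourier_neg, neg_neg, hTk] at this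
    rw [this]
    simp [triangle]

/-- `(z)_+ ^ m` is a superposition of the functions `(z - s)_+`. -/
theorem lintegral_rpow_mul_max {m : ℝ} (hm : 2 < m) (z : ℝ) :
    ∫⁻ s in Set.Ioi (0 : ℝ), ENNReal.ofReal (m * (m - 1) * s ^ (m - 2) * max 0 (z - s))
      = ENNReal.ofReal (max 0 z ^ m) := by
  rcases le_or_gt z 0 with hz | hz
  · rw [max_eq_left hz, Real.zero_rpow (by linarith), ENNReal.ofReal_zero]
    rw [setLIntegral_congr_fun measurableSet_Ioi (g := fun _ => 0), lintegral_zero]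
    intro s hs
    have hs : 0 < s := hs
    simp only
    rw [max_eq_left (by linarith), mul_zero, ENNReal.ofReal_zero]
  · have hsplit : Set.Ioi (0 : ℝ) = Set.Ioc 0 z ∪ Set.Ioi z :=
      (Set.Ioc_union_Ioi_eq_Ioi hz.le).symm
    rw [hsplit, lintegral_union measurableSet_Ioi (Set.Ioc_disjoint_Ioi le_rfl)]
    have h2 : ∫⁻ s in Set.Ioi z, ENNReal.ofReal (m * (m - 1) * s ^ (m - 2) * max 0 (z - s)) = 0 := by
      rw [setLIntegral_congr_fun measurableSet_Ioi (g := fun _ => 0), lintegral_zero]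
      intro s hs
      have hs : z < s := hs
      simp only
      rw [max_eq_left (by linarith), mul_zero, ENNReal.ofReal_zero]
    have hcont : Continuous fun s : ℝ => m * (m - 1) * s ^ (m - 2) * max 0 (z - s) := by
      have : Continuous fun s : ℝ => s ^ (m - 2) := Real.continuous_rpow_const (by linarith)
      fun_prop
    rw [h2, add_zero, ← ofReal_integral_eq_lintegral_ofReal
      (hcont.integrableOn_Icc.mono_set Set.Ioc_subset_Icc_self),
      ← intervalIntegral.integral_of_le hz.le]
    · congr 1
      -- The antiderivative vanishes at `0` and equals `z ^ m` at `z`.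
      have hd : ∀ s ∈ Set.Ioo 0 z, HasDerivAt (fun s : ℝ => m * z * s ^ (m - 1) - (m - 1) * s ^ m)
          (m * (m - 1) * s ^ (m - 2) * max 0 (z - s)) s := fun s hs => by
        have hs0 : s ≠ 0 := hs.1.ne'
        have e1 := (Real.hasDerivAt_rpow_const (x := s) (p := m - 1) (Or.inl hs0)).const_mul (m * z)
        have e2 := (Real.hasDerivAt_rpow_const (x := s) (p := m) (Or.inl hs0)).const_mul (m - 1)
        refine (e1.sub e2).congr_deriv ?_
        rw [max_eq_right (by linarith [hs.2])]
        have : s ^ (m - 1) = s ^ (m - 2) * s := by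
          rw [show m - 1 = (m - 2) + 1 by ring, Real.rpow_add_one hs0]
        rw [this, show m - 1 - 1 = m - 2 by ring]
        ring
      have c1 : Continuous fun s : ℝ => s ^ (m - 1) := Real.continuous_rpow_const (by linarith)
      have c2 : Continuous fun s : ℝ => s ^ m := Real.continuous_rpow_const (by linarith)
      rw [intervalIntegral.integral_eq_sub_of_hasDerivAt_of_le hz.le (by fun_prop) hd
        (hcont.intervalIntegrable _ _), max_eq_right hz.le, Real.zero_rpow (by linarith),
        Real.zero_rpow (by linarith)]
      have : z ^ m = z ^ (m - 1) * z := by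
        rw [← Real.rpow_add_one hz.ne']; congr 1; ring
      rw [this]; ring
    · filter_upwards [ae_restrict_mem measurableSet_Ioc] with s hs
      have := Real.rpow_nonneg hs.1.le (m - 2)
      have h3 : 0 ≤ m * (m - 1) := by nlinarith
      simp only [Pi.zero_apply]
      positivity

theorem sq_abs_rHat (l ω : ℝ) : |rHat l ω| ^ 2 = max 0 (1 - |ω|) ^ (2 * l) := by
  rw [sq_abs, rHat, mul_comm, Real.rpow_mul (le_max_left _ _), Real.rpow_two]

/-- The superposition is taken at height `1 - |(ω - ν) / a|` with exponent `2 * l`, which exceeds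
`2` because `l > 1`; Tonelli exchanges the integrals. For `s ≥ 1` the triangles are zero. -/
theorem lintegral_normSq_fourier_mul_rHat {l : ℝ} (hl : 1 < l) {a : ℝ} (ha : 0 < a) (ν : ℝ)
    (F : Lp ℂ 2 (volume : Measure ℝ)) :
    ∫⁻ ω, ENNReal.ofReal (‖(𝓕 F : Lp ℂ 2 (volume : Measure ℝ)) ω‖ ^ 2
        * |rHat l ((ω - ν) / a)| ^ 2)
      = ∫⁻ s in Set.Ioi (0 : ℝ), ENNReal.ofReal (2 * l * (2 * l - 1) * s ^ (2 * l - 2) / a) *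
        ∫⁻ ω, ENNReal.ofReal (‖(𝓕 F : Lp ℂ 2 (volume : Measure ℝ)) ω‖ ^ 2
          * triangle (a * (1 - s)) (ω - ν)) := by
  have hF : Measurable (𝓕 F : Lp ℂ 2 (volume : Measure ℝ)) := (Lp.stronglyMeasurable _).measurable
  have htri : Measurable fun p : ℝ × ℝ => triangle (a * (1 - p.1)) (p.2 - ν) := by
    unfold triangle; fun_prop
  have hpt : ∀ ω s : ℝ, s ∈ Set.Ioi (0 : ℝ) →
      ENNReal.ofReal (2 * l * (2 * l - 1) * s ^ (2 * l - 2) / a) *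
        ENNReal.ofReal (‖(𝓕 F : Lp ℂ 2 (volume : Measure ℝ)) ω‖ ^ 2
          * triangle (a * (1 - s)) (ω - ν))
      = ENNReal.ofReal (‖(𝓕 F : Lp ℂ 2 (volume : Measure ℝ)) ω‖ ^ 2) *
        ENNReal.ofReal (2 * l * (2 * l - 1) * s ^ (2 * l - 2) *
          max 0 (1 - |(ω - ν) / a| - s)) := fun ω s hs => by
    have := Real.rpow_nonneg (le_of_lt hs) (2 * l - 2)
    have h3 : 0 ≤ 2 * l * (2 * l - 1) := by nlinarith
    have h4 : triangle (a * (1 - s)) (ω - ν) = a * max 0 (1 - |(ω - ν) / a| - s) := by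
      rw [triangle, mul_max_of_nonneg _ _ ha.le, mul_zero, abs_div, abs_of_pos ha]
      congr 1
      field_simp
      ring
    rw [← ENNReal.ofReal_mul (by positivity), ← ENNReal.ofReal_mul (by positivity), h4]
    congr 1
    field_simp
  symm
  calc _ = ∫⁻ s in Set.Ioi (0 : ℝ), ∫⁻ ω,
        ENNReal.ofReal (2 * l * (2 * l - 1) * s ^ (2 * l - 2) / a) *
        ENNReal.ofReal (‖(𝓕 F : Lp ℂ 2 (volume : Measure ℝ)) ω‖ ^ 2
          * triangle (a * (1 - s)) (ω - ν)) := by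
        refine lintegral_congr fun s => (lintegral_const_mul _ ?_).symm
        have : Measurable fun ω : ℝ => triangle (a * (1 - s)) (ω - ν) :=
          htri.comp (measurable_const.prodMk measurable_id)
        fun_prop
    _ = ∫⁻ ω, ∫⁻ s in Set.Ioi (0 : ℝ),
        ENNReal.ofReal (2 * l * (2 * l - 1) * s ^ (2 * l - 2) / a) *
        ENNReal.ofReal (‖(𝓕 F : Lp ℂ 2 (volume : Measure ℝ)) ω‖ ^ 2
          * triangle (a * (1 - s)) (ω - ν)) := by
        refine lintegral_lintegral_swap (Measurable.aemeasurable ?_)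
        have h5 : Measurable fun p : ℝ × ℝ => (𝓕 F : Lp ℂ 2 (volume : Measure ℝ)) p.2 :=
          hF.comp measurable_snd
        unfold Function.uncurry
        fun_prop
    _ = _ := by
        refine lintegral_congr fun ω => ?_
        rw [setLIntegral_congr_fun measurableSet_Ioi (hpt ω),
          lintegral_const_mul _ (by fun_prop), lintegral_rpow_mul_max (by linarith),
          ENNReal.ofReal_mul (by positivity), sq_abs_rHat]

theorem lintegral_normSq_fourier_mul_rHat_le_of_abs {l : ℝ} (hl : 1 < l) {a : ℝ} (ha : 0 < a)
    (ν : ℝ) {F A : Lp ℂ 2 (volume : Measure ℝ)}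
    (hA : A =ᵐ[volume] fun x => ((‖F x‖ : ℝ) : ℂ)) :
    ∫⁻ ω, ENNReal.ofReal (‖(𝓕 F : Lp ℂ 2 (volume : Measure ℝ)) ω‖ ^ 2
        * |rHat l ((ω - ν) / a)| ^ 2)
      ≤ ∫⁻ ω, ENNReal.ofReal (‖(𝓕 A : Lp ℂ 2 (volume : Measure ℝ)) ω‖ ^ 2
        * |rHat l (ω / a)| ^ 2) := by
  have hA' := lintegral_normSq_fourier_mul_rHat hl ha 0 A
  simp only [sub_zero] at hA'
  rw [hA', lintegral_normSq_fourier_mul_rHat hl ha]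
  refine lintegral_mono fun s => mul_le_mul_right ?_ _
  obtain ⟨k, hk, h1, h2, hK⟩ := exists_nonneg_fourier_eq_triangle (a * (1 - s))
  exact lintegral_normSq_fourier_mul_le_of_abs hk h1 h2 hK (triangle_nonneg _) ν hA

/-! ### Energy balance of one layer -/

theorem rHat_nonneg (l ω : ℝ) : 0 ≤ rHat l ω := Real.rpow_nonneg (le_max_left _ _) _

theorem rHat_le_one {l : ℝ} (hl : 0 ≤ l) (ω : ℝ) : rHat l ω ≤ 1 :=
  Real.rpow_le_one (le_max_left _ _) (max_le zero_le_one (by linarith [abs_nonneg ω])) hl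

theorem sq_abs_rHat_le_one {l : ℝ} (hl : 0 ≤ l) (ω : ℝ) : |rHat l ω| ^ 2 ≤ 1 := by
  rw [abs_of_nonneg (rHat_nonneg l ω)]
  exact pow_le_one₀ (rHat_nonneg l ω) (rHat_le_one hl ω)

theorem sq_abs_rHat_anti {l : ℝ} (hl : 0 ≤ l) {u v : ℝ} (h : |u| ≤ |v|) :
    |rHat l v| ^ 2 ≤ |rHat l u| ^ 2 := by
  rw [sq_abs_rHat, sq_abs_rHat]
  gcongr

theorem rHat_eq_zero {l : ℝ} (hl : l ≠ 0) {u : ℝ} (h : 1 ≤ |u|) : rHat l u = 0 := by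
  rw [rHat, max_eq_left (by linarith), Real.zero_rpow hl]

theorem measurable_sq_abs_rHat (l : ℝ) : Measurable fun ω => |rHat l ω| ^ 2 := by
  unfold rHat; fun_prop

theorem eLpNorm_two_sq (f : ℝ → ℂ) :
    eLpNorm f 2 volume ^ 2 = ∫⁻ x, ENNReal.ofReal (‖f x‖ ^ 2) := by
  have h := eLpNorm_nnreal_pow_eq_lintegral (f := f) (μ := volume) (p := 2) two_ne_zero
  simp only [NNReal.coe_ofNat, ENNReal.rpow_ofNat, ENNReal.coe_ofNat] at h
  rw [h]
  refine lintegral_congr fun x => ?_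
  rw [ENNReal.ofReal_pow (norm_nonneg _), ofReal_norm]

theorem eLpNorm_fourier (F : Lp ℂ 2 (volume : Measure ℝ)) :
    eLpNorm (𝓕 F : Lp ℂ 2 (volume : Measure ℝ)) 2 volume = eLpNorm F 2 volume := by
  rw [← Lp.enorm_def, ← Lp.enorm_def, ← ofReal_norm, ← ofReal_norm,
    Lp.norm_fourier_eq]

theorem lintegral_normSq_fourier_mul_compl_add (F : Lp ℂ 2 (volume : Measure ℝ)) {p : ℝ → ℝ}
    (hp : Measurable p) (h0 : ∀ ω, 0 ≤ p ω) (h1 : ∀ ω, p ω ≤ 1) :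
    (∫⁻ ω, ENNReal.ofReal (‖(𝓕 F : Lp ℂ 2 (volume : Measure ℝ)) ω‖ ^ 2 * (1 - p ω))) +
      ∫⁻ ω, ENNReal.ofReal (‖(𝓕 F : Lp ℂ 2 (volume : Measure ℝ)) ω‖ ^ 2 * p ω)
      = eLpNorm F 2 volume ^ 2 := by
  have hF : Measurable (𝓕 F : Lp ℂ 2 (volume : Measure ℝ)) := (Lp.stronglyMeasurable _).measurable
  rw [← eLpNorm_fourier, eLpNorm_two_sq, ← lintegral_add_right _ (by fun_prop)]
  refine lintegral_congr fun ω => ?_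
  have := h0 ω
  have := sub_nonneg.2 (h1 ω)
  rw [← ENNReal.ofReal_add (by positivity) (by positivity)]
  congr 1
  ring

theorem memLp_layer {g : ℝ → ℂ} (h1 : Integrable g) (h2 : MemLp g 2 volume)
    (f : Lp ℂ 2 (volume : Measure ℝ)) : MemLp (layer g f) 2 volume :=
  (memLp_convolution h1 h2 f).norm.ofReal

theorem eLpNorm_layer_sq {g : ℝ → ℂ} (h1 : Integrable g) (h2 : MemLp g 2 volume)
    (f : Lp ℂ 2 (volume : Measure ℝ)) :
    eLpNorm (layer g f) 2 volume ^ 2 = ∫⁻ ω, ENNReal.ofReal (‖𝓕 g ω‖ ^ 2 *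
      (‖(𝓕 f : Lp ℂ 2 (volume : Measure ℝ)) ω‖ ^ 2 * 1)) := by
  have e : eLpNorm (layer g f) 2 volume
      = eLpNorm ((memLp_convolution h1 h2 f).toLp _ : Lp ℂ 2 (volume : Measure ℝ)) 2 volume := by
    refine eLpNorm_congr_norm_ae ?_
    filter_upwards [(memLp_convolution h1 h2 f).coeFn_toLp] with x hx
    rw [hx]
    simp [layer]
  rw [e, ← eLpNorm_fourier, eLpNorm_two_sq]
  refine lintegral_congr_ae ?_
  filter_upwards [fourier_convolution_ae_eq h1 h2 f] with ω hω
  rw [hω, norm_mul, mul_pow, mul_one]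

/-- The modulus preserves the total energy, so the gain in low-pass energy is a loss in high-pass
energy. The shift `ν` may be chosen separately for each filter. -/
theorem highPassEnergy_layer_le {l : ℝ} (hl : 1 < l) {b : ℝ} (hb : 0 < b) (ν : ℝ) {g : ℝ → ℂ}
    (h1 : Integrable g) (h2 : MemLp g 2 volume) (f : Lp ℂ 2 (volume : Measure ℝ)) :
    highPassEnergy l b ((memLp_layer h1 h2 f).toLp _) ≤ ∫⁻ ω, ENNReal.ofReal (‖𝓕 g ω‖ ^ 2 *
      (‖(𝓕 f : Lp ℂ 2 (volume : Measure ℝ)) ω‖ ^ 2 * (1 - |rHat l ((ω - ν) / b)| ^ 2))) := by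
  have hl0 : 0 ≤ l := by linarith
  set F : Lp ℂ 2 (volume : Measure ℝ) := (memLp_convolution h1 h2 f).toLp _ with hFdef
  set A : Lp ℂ 2 (volume : Measure ℝ) := (memLp_layer h1 h2 f).toLp _ with hAdef
  have hA : A =ᵐ[volume] fun x => ((‖F x‖ : ℝ) : ℂ) := by
    filter_upwards [(memLp_convolution h1 h2 f).coeFn_toLp, (memLp_layer h1 h2 f).coeFn_toLp]
      with x e1 e2
    rw [e1, e2, layer]
  have hAF : eLpNorm A 2 volume = eLpNorm F 2 volume := by
    refine eLpNorm_congr_norm_ae ?_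
    filter_upwards [hA] with x hx
    rw [hx]; simp
  have sA := lintegral_normSq_fourier_mul_compl_add A
    (p := fun ω => |rHat l (ω / b)| ^ 2) ((measurable_sq_abs_rHat l).comp (by fun_prop))
    (fun _ => by positivity) (fun _ => sq_abs_rHat_le_one hl0 _)
  have sF := lintegral_normSq_fourier_mul_compl_add F
    (p := fun ω => |rHat l ((ω - ν) / b)| ^ 2) ((measurable_sq_abs_rHat l).comp (by fun_prop))
    (fun _ => by positivity) (fun _ => sq_abs_rHat_le_one hl0 _)
  have hle := lintegral_normSq_fourier_mul_rHat_le_of_abs hl hb ν hA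
  have hfin : eLpNorm F 2 volume ^ 2 ≠ ∞ := ENNReal.pow_ne_top (Lp.memLp F).2.ne
  have hX : ∫⁻ ω, ENNReal.ofReal (‖𝓕 g ω‖ ^ 2 *
      (‖(𝓕 f : Lp ℂ 2 (volume : Measure ℝ)) ω‖ ^ 2 * (1 - |rHat l ((ω - ν) / b)| ^ 2)))
      = ∫⁻ ω, ENNReal.ofReal (‖(𝓕 F : Lp ℂ 2 (volume : Measure ℝ)) ω‖ ^ 2 *
        (1 - |rHat l ((ω - ν) / b)| ^ 2)) := by
    refine lintegral_congr_ae ?_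
    filter_upwards [fourier_convolution_ae_eq h1 h2 f] with ω hω
    rw [hω, norm_mul, mul_pow, mul_assoc]
  rw [hX]
  rw [hAF, ← sF] at sA
  -- Finiteness permits cancelling the low-pass term in `ℝ≥0∞`.
  have hZ : ∫⁻ ω, ENNReal.ofReal (‖(𝓕 F : Lp ℂ 2 (volume : Measure ℝ)) ω‖ ^ 2
      * |rHat l ((ω - ν) / b)| ^ 2) ≠ ∞ := by
    intro h
    rw [h, add_top] at sF
    exact hfin sF.symm
  refine ENNReal.le_of_add_le_add_right hZ ?_
  rw [← sA]
  exact add_le_add_right hle _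

/-! ### Induction over the layers -/

theorem layer_congr {g f f' : ℝ → ℂ} (h : f =ᵐ[volume] f') : layer g f = layer g f' := by
  ext x
  have : convolution f g (ContinuousLinearMap.mul ℂ ℂ) volume x
      = convolution f' g (ContinuousLinearMap.mul ℂ ℂ) volume x := by
    refine integral_congr_ae ?_
    filter_upwards [h] with t ht
    rw [ht]
  rw [layer, layer, this]

theorem energy_congr {ι : Type} (g : ι → ℝ → ℂ) (N : ℕ) {f f' : ℝ → ℂ} (h : f =ᵐ[volume] f') :
    energy g N f = energy g N f' := by
  cases N with
  | zero =>
    refine tsum_congr fun q => ?_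
    simp only [featureMap]
    rw [eLpNorm_congr_ae h]
  | succ N => simp only [energy, featureMap, layer_congr h]

theorem energy_zero {ι : Type} (g : ι → ℝ → ℂ) (f : ℝ → ℂ) :
    energy g 0 f = eLpNorm f 2 volume ^ 2 := by
  simp [energy, featureMap]

theorem energy_succ {ι : Type} (g : ι → ℝ → ℂ) (N : ℕ) (f : ℝ → ℂ) :
    energy g (N + 1) f = ∑' i, energy g N (layer (g i) f) := by
  unfold energy
  rw [← (Fin.consEquiv fun _ : Fin (N + 1) => ι).tsum_eq, ENNReal.tsum_prod']
  rfl

/-- Filter-dependent weights are replaced by a common one, needed only where the filter is nonzero;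
the Littlewood-Paley bound then removes the filters. -/
theorem tsum_lintegral_le {ι : Type} [Countable ι] {g : ι → ℝ → ℂ} (h1 : ∀ i, Integrable (g i))
    (hsum : ∀ᵐ ω : ℝ, ∑' i, ENNReal.ofReal (‖𝓕 (g i) ω‖ ^ 2) ≤ 1)
    {w : ι → ℝ → ℝ} {v : ℝ → ℝ} (hv : Measurable v)
    (hw : ∀ i ω, 𝓕 (g i) ω ≠ 0 → w i ω ≤ v ω) (f : Lp ℂ 2 (volume : Measure ℝ)) :
    ∑' i, ∫⁻ ω, ENNReal.ofReal (‖𝓕 (g i) ω‖ ^ 2 *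
      (‖(𝓕 f : Lp ℂ 2 (volume : Measure ℝ)) ω‖ ^ 2 * w i ω))
      ≤ ∫⁻ ω, ENNReal.ofReal (‖(𝓕 f : Lp ℂ 2 (volume : Measure ℝ)) ω‖ ^ 2 * v ω) := by
  have hF : Measurable (𝓕 f : Lp ℂ 2 (volume : Measure ℝ)) := (Lp.stronglyMeasurable _).measurable
  calc _ ≤ ∑' i, ∫⁻ ω, ENNReal.ofReal (‖𝓕 (g i) ω‖ ^ 2) *
        ENNReal.ofReal (‖(𝓕 f : Lp ℂ 2 (volume : Measure ℝ)) ω‖ ^ 2 * v ω) := by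
        refine ENNReal.tsum_le_tsum fun i => lintegral_mono fun ω => ?_
        rw [← ENNReal.ofReal_mul (by positivity)]
        refine ENNReal.ofReal_le_ofReal ?_
        by_cases h : 𝓕 (g i) ω = 0
        · simp [h]
        · have := hw i ω h
          gcongr
    _ = ∫⁻ ω, ∑' i, ENNReal.ofReal (‖𝓕 (g i) ω‖ ^ 2) *
        ENNReal.ofReal (‖(𝓕 f : Lp ℂ 2 (volume : Measure ℝ)) ω‖ ^ 2 * v ω) := by
        refine (lintegral_tsum fun i => Measurable.aemeasurable ?_).symm
        have := (continuous_fourier (h1 i)).measurable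
        fun_prop
    _ ≤ _ := by
        refine lintegral_mono_ae ?_
        filter_upwards [hsum] with ω hω
        rw [ENNReal.tsum_mul_right]
        exact mul_le_of_le_one_left' hω

/-- Energy decay for networks whose filters are high-pass with Fourier supports that can each be
demodulated to relative bandwidth `1 / a`. -/
theorem energy_succ_le_highPassEnergy {ι : Type} [Countable ι] {g : ι → ℝ → ℂ} {l a R : ℝ}
    (hl : 1 < l) (ha : 0 < a) (hR : 0 < R) (h1 : ∀ i, Integrable (g i))
    (h2 : ∀ i, MemLp (g i) 2 volume)
    (hsum : ∀ᵐ ω : ℝ, ∑' i, ENNReal.ofReal (‖𝓕 (g i) ω‖ ^ 2) ≤ 1)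
    (hhigh : ∀ i ω, 𝓕 (g i) ω ≠ 0 → R ≤ |ω|)
    (ν : ι → ℝ) (hν : ∀ i ω, 𝓕 (g i) ω ≠ 0 → |ω - ν i| ≤ |ω| / a) (N : ℕ)
    (f : Lp ℂ 2 (volume : Measure ℝ)) :
    energy g (N + 1) f ≤ highPassEnergy l (a ^ N * R) f := by
  have hl0 : 0 ≤ l := by linarith
  have hmeas : ∀ b : ℝ, Measurable fun ω => 1 - |rHat l (ω / b)| ^ 2 := fun b =>
    measurable_const.sub ((measurable_sq_abs_rHat l).comp (measurable_id.div_const b))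
  rw [energy_succ]
  induction N generalizing f with
  | zero =>
    simp_rw [energy_zero, eLpNorm_layer_sq (h1 _) (h2 _)]
    refine tsum_lintegral_le h1 hsum (w := fun _ _ => 1) (hmeas _) (fun i ω hi => ?_) f
    -- The filters live on `|ω| ≥ R`, where the cutoff at `R` vanishes, so the weight is exactly
    -- `1`.
    rw [rHat_eq_zero (by linarith)]
    · simp
    · rw [pow_zero, one_mul, abs_div, abs_of_pos hR, one_le_div hR]
      exact hhigh i ω hi
  | succ N ih =>
    have hb : 0 < a ^ N * R := by positivity
    refine (ENNReal.tsum_le_tsum fun i => ?_).trans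
      (tsum_lintegral_le h1 hsum (w := fun i ω => 1 - |rHat l ((ω - ν i) / (a ^ N * R))| ^ 2)
        (hmeas _) (fun i ω hi => ?_) f)
    · rw [energy_congr g (N + 1) (memLp_layer (h1 i) (h2 i) f).coeFn_toLp.symm, energy_succ]
      exact (ih _).trans (highPassEnergy_layer_le hl hb (ν i) (h1 i) (h2 i) f)
    -- Demodulation shrinks the frequency by `a`, which is traded for one more factor `a` in the
    -- cutoff.
    · refine sub_le_sub_left (sq_abs_rHat_anti hl0 ?_) _
      rw [abs_div, abs_div, abs_of_pos hb, abs_of_pos (by positivity : 0 < a ^ (N + 1) * R),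
        div_le_div_iff₀ hb (by positivity)]
      have := (le_div_iff₀ ha).1 (hν i ω hi)
      calc |ω - ν i| * (a ^ (N + 1) * R) = (|ω - ν i| * a) * (a ^ N * R) := by ring
        _ ≤ _ := by gcongr

/-! ### Decay rate for Sobolev functions -/

/-- Bernoulli's inequality gives `p * x` for `x < 1`, and `x ≤ x ^ γ` there; for `x ≥ 1` the right
side is at least `1`. The linear behaviour at `0` is what caps the rate at `γ = 1`. -/
theorem one_sub_max_rpow_le {p γ x : ℝ} (hp : 1 ≤ p) (hγ0 : 0 ≤ γ) (hγ : γ ≤ 1) (hx : 0 ≤ x) :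
    1 - max 0 (1 - x) ^ p ≤ p * x ^ γ := by
  rcases le_or_gt 1 x with h | h
  · have h1 : 1 ≤ x ^ γ := Real.one_le_rpow h hγ0
    have h2 : 0 ≤ max 0 (1 - x) ^ p := Real.rpow_nonneg (le_max_left _ _) _
    nlinarith
  · rw [max_eq_right (by linarith)]
    have h1 := one_add_mul_self_le_rpow_one_add (s := -x) (by linarith) hp
    have h2 : x ≤ x ^ γ := by
      rcases hx.eq_or_lt with rfl | hx
      · exact Real.rpow_nonneg le_rfl _
      · simpa using Real.rpow_le_rpow_of_exponent_ge hx h.le hγ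
    rw [← sub_eq_add_neg] at h1
    nlinarith

theorem abs_rpow_le_one_add_sq_rpow {γ s : ℝ} (hγ0 : 0 ≤ γ) (hγ : γ ≤ 2 * s) (ω : ℝ) :
    |ω| ^ γ ≤ (1 + |ω| ^ 2) ^ s := by
  have h1 : |ω| ^ γ = (|ω| ^ 2) ^ (γ / 2) := by
    rw [← Real.rpow_natCast, ← Real.rpow_mul (abs_nonneg _)]
    congr 1
    push_cast
    ring
  rw [h1]
  calc (|ω| ^ 2) ^ (γ / 2) ≤ (1 + |ω| ^ 2) ^ (γ / 2) := by gcongr; linarith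
    _ ≤ _ := Real.rpow_le_rpow_of_exponent_le (by nlinarith [sq_nonneg |ω|]) (by linarith)

theorem highPassEnergy_le_of_memSobolevSpace {l s γ b : ℝ} (hl : 1 < l) (hγ0 : 0 ≤ γ)
    (hγ1 : γ ≤ 1) (hγs : γ ≤ 2 * s) (hb : 0 < b) (f : Lp ℂ 2 (volume : Measure ℝ)) :
    highPassEnergy l b f ≤ ENNReal.ofReal (2 * l * b ^ (-γ)) * ∫⁻ ω : ℝ,
      ENNReal.ofReal ((1 + |ω| ^ 2) ^ s * ‖(𝓕 f : Lp ℂ 2 (volume : Measure ℝ)) ω‖ ^ 2) := by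
  have hF : Measurable (𝓕 f : Lp ℂ 2 (volume : Measure ℝ)) := (Lp.stronglyMeasurable _).measurable
  rw [← lintegral_const_mul _ (by fun_prop)]
  refine lintegral_mono fun ω => ?_
  rw [← ENNReal.ofReal_mul (by positivity)]
  refine ENNReal.ofReal_le_ofReal ?_
  have h1 := one_sub_max_rpow_le (p := 2 * l) (by linarith) hγ0 hγ1 (abs_nonneg (ω / b))
  have h2 := abs_rpow_le_one_add_sq_rpow hγ0 hγs ω
  rw [abs_div, abs_of_pos hb, Real.div_rpow (abs_nonneg _) hb.le, ← abs_of_pos hb, ← abs_div,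
    abs_of_pos hb] at h1
  rw [sq_abs_rHat]
  calc _ ≤ ‖(𝓕 f : Lp ℂ 2 (volume : Measure ℝ)) ω‖ ^ 2 * (2 * l * (|ω| ^ γ / b ^ γ)) := by
        gcongr
    _ ≤ ‖(𝓕 f : Lp ℂ 2 (volume : Measure ℝ)) ω‖ ^ 2 * (2 * l * ((1 + |ω| ^ 2) ^ s / b ^ γ)) := by
        gcongr
    _ = _ := by rw [Real.rpow_neg hb.le]; ring

theorem exists_decay_of_memSobolevSpace {l a R : ℝ} (hl : 1 < l) (ha : 0 < a) (hR : 0 < R)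
    {W : ℕ → ℝ≥0∞} {f : Lp ℂ 2 (volume : Measure ℝ)}
    (hW : ∀ N, 1 ≤ N → W N ≤ highPassEnergy l (a ^ (N - 1) * R) f) {s : ℝ} (hs : 0 < s)
    (hf : MemSobolevSpace s f) :
    ∃ C : ℝ, 0 < C ∧ ∃ N₀ : ℕ, ∀ N : ℕ, N₀ ≤ N →
      W N ≤ ENNReal.ofReal (C * a ^ (-(min 1 (2 * s) * (N : ℝ)))) := by
  set γ := min 1 (2 * s) with hγ
  set S := ∫⁻ ω : ℝ, ENNReal.ofReal ((1 + |ω| ^ 2) ^ s *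
    ‖(𝓕 f : Lp ℂ 2 (volume : Measure ℝ)) ω‖ ^ 2) with hS
  have hSfin : S ≠ ∞ := ne_of_lt hf
  -- The factor `a ^ γ` compensates for the exponent `N - 1` in the cutoff; adding `1` keeps the
  -- constant positive when `f = 0`.
  refine ⟨2 * l * (a ^ γ * R ^ (-γ)) * (S.toReal + 1), by positivity, 1, fun N hN => ?_⟩
  refine (hW N hN).trans ((highPassEnergy_le_of_memSobolevSpace hl (γ := γ)
    (le_min zero_le_one (by linarith)) (min_le_left _ _) (min_le_right _ _)
    (by positivity) f).trans ?_)
  rw [← hS, ← ENNReal.ofReal_toReal hSfin, ← ENNReal.ofReal_mul (by positivity)]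
  refine ENNReal.ofReal_le_ofReal ?_
  have e : (a ^ (N - 1) * R) ^ (-γ) = a ^ γ * R ^ (-γ) * a ^ (-(γ * (N : ℝ))) := by
    rw [Real.mul_rpow (by positivity) hR.le, ← Real.rpow_natCast, ← Real.rpow_mul ha.le,
      mul_right_comm, ← Real.rpow_add ha, Nat.cast_sub hN]
    congr 2
    push_cast
    ring
  rw [e, ENNReal.toReal_ofReal ENNReal.toReal_nonneg]
  have : 0 ≤ 2 * l * (a ^ γ * R ^ (-γ)) * a ^ (-(γ * (N : ℝ))) := by positivity
  nlinarith

/-! ### The two filter families in frequency -/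

theorem memLp_comp_mul_left {f : ℝ → ℂ} {p : ℝ≥0∞} (hf : MemLp f p volume) {c : ℝ} (hc : c ≠ 0) :
    MemLp (fun x => f (c * x)) p volume := by
  have h : MemLp f p (Measure.map (c * ·) volume) := by
    rw [Real.map_volume_mul_left hc]
    exact hf.smul_measure ENNReal.ofReal_ne_top
  exact h.comp_of_map (by fun_prop)

/-- Negative `c` is allowed, so reflected wavelets are covered by the same formula. -/
theorem fourier_dilate (f : ℝ → ℂ) {c : ℝ} (hc : c ≠ 0) (ω : ℝ) :
    𝓕 (fun x => ((|c| : ℝ) : ℂ) * f (c * x)) ω = 𝓕 f (ω / c) := by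
  rw [Real.fourier_real_eq, Real.fourier_real_eq]
  have h := Measure.integral_comp_mul_left
    (fun x => Real.fourierChar (-(x * (ω / c))) • f x) c
  have hc' : |c| ≠ 0 := abs_ne_zero.2 hc
  have h2 : ∫ x, Real.fourierChar (-(x * (ω / c))) • f x
      = |c| • ∫ x, Real.fourierChar (-(c * x * (ω / c))) • f (c * x) := by
    rw [h, smul_smul, abs_inv, mul_inv_cancel₀ hc', one_smul]
  rw [h2, ← integral_smul]
  refine integral_congr_ae (Filter.Eventually.of_forall fun x => ?_)
  have e : c * x * (ω / c) = x * ω := by field_simp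
  simp only [e, Circle.smul_def, smul_eq_mul, Complex.real_smul]
  ring

/-- The dilation factor `sign(j) 2 ^ |j|` of the `j`-th wavelet filter. -/
noncomputable def waveletScale (j : {j : ℤ // j ≠ 0}) : ℝ :=
  if 0 < j.1 then 2 ^ j.1.natAbs else -2 ^ j.1.natAbs

theorem abs_waveletScale (j : {j : ℤ // j ≠ 0}) : |waveletScale j| = 2 ^ j.1.natAbs := by
  unfold waveletScale
  split_ifs <;> simp

theorem waveletScale_ne_zero (j : {j : ℤ // j ≠ 0}) : waveletScale j ≠ 0 := by
  rw [← abs_ne_zero, abs_waveletScale]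
  positivity

theorem two_le_abs_waveletScale (j : {j : ℤ // j ≠ 0}) : 2 ≤ |waveletScale j| := by
  rw [abs_waveletScale]
  exact le_self_pow₀ one_le_two (Int.natAbs_ne_zero.2 j.2)

theorem waveletFilter_eq (ψ : ℝ → ℂ) (j : {j : ℤ // j ≠ 0}) :
    waveletFilter ψ j = fun x => ((|waveletScale j| : ℝ) : ℂ) * ψ (waveletScale j * x) := by
  ext x
  rw [abs_waveletScale, waveletFilter, waveletScale]
  split_ifs <;> simp

theorem fourier_waveletFilter (ψ : ℝ → ℂ) (j : {j : ℤ // j ≠ 0}) (ω : ℝ) :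
    𝓕 (waveletFilter ψ j) ω = 𝓕 ψ (ω / waveletScale j) := by
  rw [waveletFilter_eq, fourier_dilate ψ (waveletScale_ne_zero j)]

theorem memLp_waveletFilter {ψ : ℝ → ℂ} {p : ℝ≥0∞} (hψ : MemLp ψ p volume)
    (j : {j : ℤ // j ≠ 0}) : MemLp (waveletFilter ψ j) p volume := by
  rw [waveletFilter_eq]
  exact (memLp_comp_mul_left hψ (waveletScale_ne_zero j)).const_mul _

/-- The frequency shift `sign(k) (|k| + 1) R` of the `k`-th Weyl-Heisenberg filter. -/
noncomputable def weylHeisenbergShift (R : ℝ) (k : {k : ℤ // k ≠ 0}) : ℝ :=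
  if 0 < k.1 then ((k.1.natAbs : ℝ) + 1) * R else -(((k.1.natAbs : ℝ) + 1) * R)

theorem weylHeisenbergFilter_eq (R : ℝ) (g : ℝ → ℂ) (k : {k : ℤ // k ≠ 0}) :
    weylHeisenbergFilter R g k
      = fun x => Real.fourierChar (weylHeisenbergShift R k * x) • g x := by
  ext x
  rw [weylHeisenbergFilter, weylHeisenbergShift, Circle.smul_def, smul_eq_mul,
    Real.fourierChar_apply]
  split_ifs <;> · push_cast; ring_nf

theorem fourier_weylHeisenbergFilter (R : ℝ) (g : ℝ → ℂ) (k : {k : ℤ // k ≠ 0}) (ω : ℝ) :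
    𝓕 (weylHeisenbergFilter R g k) ω = 𝓕 g (ω - weylHeisenbergShift R k) := by
  rw [weylHeisenbergFilter_eq, fourier_modulate]

theorem memLp_weylHeisenbergFilter (R : ℝ) {g : ℝ → ℂ} {p : ℝ≥0∞} (hg : MemLp g p volume)
    (k : {k : ℤ // k ≠ 0}) : MemLp (weylHeisenbergFilter R g k) p volume := by
  rw [weylHeisenbergFilter_eq]
  exact memLp_modulate hg _

/-! ### Littlewood-Paley sums over the nonzero integers -/

/-- At a given frequency only one half of the family contributes; `e` enumerates that half. -/
theorem tsum_ofReal_le_one {ι : Type} {u : ι → ℝ} {v : ℕ → ℝ} {S : ℝ} (hv : HasSum v S)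
    (hv0 : ∀ n, 0 ≤ v n) (hS : S ≤ 1) {e : ℕ → ι} (he : Function.Injective e)
    (hu : ∀ n, u (e n) = v n) (hsupp : ∀ i, u i ≠ 0 → i ∈ Set.range e) :
    ∑' i, ENNReal.ofReal (u i) ≤ 1 := by
  rw [← he.tsum_eq (f := fun i => ENNReal.ofReal (u i))]
  · simp_rw [hu]
    rw [← ENNReal.ofReal_tsum_of_nonneg hv0 hv.summable, hv.tsum_eq]
    simpa using ENNReal.ofReal_le_ofReal hS
  · intro i hi
    exact hsupp i fun h => hi (by simp [h])

/-- The embedding `n ↦ n + 1` of `ℕ` into the nonzero integers. -/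
def posIndex (n : ℕ) : {j : ℤ // j ≠ 0} := ⟨n + 1, by lia⟩

/-- The embedding `n ↦ -(n + 1)` of `ℕ` into the nonzero integers. -/
def negIndex (n : ℕ) : {j : ℤ // j ≠ 0} := ⟨-(n + 1), by lia⟩

theorem posIndex_injective : Function.Injective posIndex := fun a b h => by
  have := congrArg Subtype.val h
  simp only [posIndex] at this
  lia

theorem negIndex_injective : Function.Injective negIndex := fun a b h => by
  have := congrArg Subtype.val h
  simp only [negIndex] at this
  lia

theorem mem_range_posIndex {j : {j : ℤ // j ≠ 0}} (h : 0 < j.1) : j ∈ Set.range posIndex :=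
  ⟨j.1.natAbs - 1, Subtype.ext (by simp only [posIndex]; lia)⟩

theorem mem_range_negIndex {j : {j : ℤ // j ≠ 0}} (h : ¬ 0 < j.1) : j ∈ Set.range negIndex :=
  ⟨j.1.natAbs - 1, Subtype.ext (by have := j.2; simp only [negIndex]; lia)⟩

/-- A Littlewood-Paley identity on the nonnegative half-line bounds the Littlewood-Paley sum of a
family indexed by the nonzero integers, if the two halves of the family live on opposite
half-lines and are mirror images of each other. -/
theorem ae_tsum_ofReal_le_one {u : {j : ℤ // j ≠ 0} → ℝ → ℝ} {v : ℕ → ℝ → ℝ} {S : ℝ → ℝ}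
    (h : ∀ᵐ ω : ℝ, 0 ≤ ω → HasSum (fun n => v n ω) (S ω)) (hv0 : ∀ n ω, 0 ≤ v n ω)
    (hS : ∀ ω, S ω ≤ 1) (hpos : ∀ n ω, u (posIndex n) ω = v n ω)
    (hneg : ∀ n ω, u (negIndex n) ω = v n (-ω))
    (hpos_supp : ∀ j ω, u j ω ≠ 0 → 0 ≤ ω → 0 < j.1)
    (hneg_supp : ∀ j ω, u j ω ≠ 0 → ω < 0 → ¬ 0 < j.1) :
    ∀ᵐ ω : ℝ, ∑' j, ENNReal.ofReal (u j ω) ≤ 1 := by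
  filter_upwards [h, (Measure.measurePreserving_neg (volume : Measure ℝ)).quasiMeasurePreserving.ae
    h] with ω h1 h2
  rcases le_or_gt 0 ω with hω | hω
  · exact tsum_ofReal_le_one (h1 hω) (fun n => hv0 n ω) (hS ω) posIndex_injective
      (fun n => hpos n ω) fun j hj => mem_range_posIndex (hpos_supp j ω hj hω)
  · exact tsum_ofReal_le_one (h2 (by linarith)) (fun n => hv0 n _) (hS _) negIndex_injective
      (fun n => hneg n ω) fun j hj => mem_range_negIndex (hneg_supp j ω hj hω)

theorem waveletScale_posIndex (n : ℕ) : waveletScale (posIndex n) = 2 ^ (n + 1) := by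
  have h1 : (posIndex n).1.natAbs = n + 1 := by simp only [posIndex]; lia
  have h2 : 0 < (posIndex n).1 := by simp only [posIndex]; lia
  rw [waveletScale, if_pos h2, h1]

theorem waveletScale_negIndex (n : ℕ) : waveletScale (negIndex n) = -2 ^ (n + 1) := by
  have h1 : (negIndex n).1.natAbs = n + 1 := by simp only [negIndex]; lia
  have h2 : ¬ 0 < (negIndex n).1 := by simp only [negIndex]; lia
  rw [waveletScale, if_neg h2, h1]

theorem weylHeisenbergShift_posIndex (R : ℝ) (n : ℕ) :
    weylHeisenbergShift R (posIndex n) = R * (((n + 1 : ℕ) : ℝ) + 1) := by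
  have h1 : (posIndex n).1.natAbs = n + 1 := by simp only [posIndex]; lia
  have h2 : 0 < (posIndex n).1 := by simp only [posIndex]; lia
  rw [weylHeisenbergShift, if_pos h2, h1, mul_comm]

theorem weylHeisenbergShift_negIndex (R : ℝ) (n : ℕ) :
    weylHeisenbergShift R (negIndex n) = -(R * (((n + 1 : ℕ) : ℝ) + 1)) := by
  have h1 : (negIndex n).1.natAbs = n + 1 := by simp only [negIndex]; lia
  have h2 : ¬ 0 < (negIndex n).1 := by simp only [negIndex]; lia
  rw [weylHeisenbergShift, if_neg h2, h1, mul_comm]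

theorem mem_of_tsupport_subset {f : ℝ → ℂ} {s : Set ℝ} (h : tsupport f ⊆ s) {x : ℝ}
    (hx : f x ≠ 0) : x ∈ s := h (subset_tsupport f hx)

/-! ### Demodulation constants for the two families -/

theorem energy_waveletFilter_le {l : ℝ} (hl : 1 < l) {ψ φ : ℝ → ℂ} (h1 : MemLp ψ 1 volume)
    (h2 : MemLp ψ 2 volume) (hsupp : tsupport (𝓕 ψ) ⊆ Set.Icc (1 / 2 : ℝ) 2)
    (hLP : ∀ᵐ ω : ℝ, 0 ≤ ω →
      HasSum (fun j : ℕ => ‖𝓕 ψ (ω / 2 ^ (j + 1))‖ ^ 2) (1 - ‖𝓕 φ ω‖ ^ 2))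
    (f : Lp ℂ 2 (volume : Measure ℝ)) (N : ℕ) :
    energy (waveletFilter ψ) (N + 1) f ≤ highPassEnergy l ((5 / 3) ^ N * 1) f := by
  have hmem : ∀ (j : {j : ℤ // j ≠ 0}) (ω : ℝ), 𝓕 (waveletFilter ψ j) ω ≠ 0 →
      ∃ y ∈ Set.Icc (1 / 2 : ℝ) 2, ω = waveletScale j * y := fun j ω hω => by
    rw [fourier_waveletFilter] at hω
    exact ⟨_, mem_of_tsupport_subset hsupp hω, (mul_div_cancel₀ ω (waveletScale_ne_zero j)).symm⟩
  -- The centre `4/5` equalizes the relative distance `|y - 4/5| / y` at the endpoints `1/2` and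
  -- `2`; both values are `3/5`, whence `a = 5/3`. The smallest dilation `2` times `1/2` gives the
  -- lower frequency edge `1`.
  refine energy_succ_le_highPassEnergy hl (by norm_num) one_pos
    (fun j => memLp_one_iff_integrable.1 (memLp_waveletFilter h1 j))
    (fun j => memLp_waveletFilter h2 j) ?_ ?_ (fun j => waveletScale j * (4 / 5)) ?_ N f
  · refine ae_tsum_ofReal_le_one hLP (fun _ _ => by positivity)
      (fun ω => by nlinarith [sq_nonneg ‖𝓕 φ ω‖]) (fun n ω => ?_) (fun n ω => ?_)
      (fun j ω hj hω => ?_) (fun j ω hj hω => ?_)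
    · rw [fourier_waveletFilter, waveletScale_posIndex]
    · rw [fourier_waveletFilter, waveletScale_negIndex, div_neg, neg_div]
    · obtain ⟨y, hy, rfl⟩ := hmem j ω fun h => hj (by simp [h])
      by_contra hj'
      rw [waveletScale, if_neg hj'] at hω
      have : (0 : ℝ) < 2 ^ j.1.natAbs := by positivity
      nlinarith [hy.1]
    · obtain ⟨y, hy, rfl⟩ := hmem j ω fun h => hj (by simp [h])
      intro hj'
      rw [waveletScale, if_pos hj'] at hω
      have : (0 : ℝ) < 2 ^ j.1.natAbs := by positivity
      nlinarith [hy.1]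
  · intro j ω hω
    obtain ⟨y, hy, rfl⟩ := hmem j ω hω
    rw [abs_mul]
    have := two_le_abs_waveletScale j
    have := hy.1
    rw [abs_of_nonneg (by linarith : 0 ≤ y)]
    nlinarith
  · intro j ω hω
    obtain ⟨y, hy, rfl⟩ := hmem j ω hω
    rw [← mul_sub, abs_mul, abs_mul, mul_div_assoc]
    gcongr
    have h3 := hy.1
    have h4 := hy.2
    rw [abs_of_nonneg (by linarith : 0 ≤ y), abs_le]
    constructor <;> linarith

theorem energy_weylHeisenbergFilter_le {l R : ℝ} (hl : 1 < l) (hR : 0 < R) {g φ : ℝ → ℂ}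
    (h1 : MemLp g 1 volume) (h2 : MemLp g 2 volume) (hsupp : tsupport (𝓕 g) ⊆ Set.Icc (-R) R)
    (heven : ∀ ω : ℝ, 𝓕 g (-ω) = 𝓕 g ω)
    (hLP : ∀ᵐ ω : ℝ, 0 ≤ ω →
      HasSum (fun k : ℕ => ‖𝓕 g (ω - R * (((k + 1 : ℕ) : ℝ) + 1))‖ ^ 2) (1 - ‖𝓕 φ ω‖ ^ 2))
    (f : Lp ℂ 2 (volume : Measure ℝ)) (N : ℕ) :
    energy (weylHeisenbergFilter R g) (N + 1) f ≤ highPassEnergy l ((3 / 2) ^ N * R) f := by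
  have hmem : ∀ (k : {k : ℤ // k ≠ 0}) (ω : ℝ), 𝓕 (weylHeisenbergFilter R g k) ω ≠ 0 →
      ω - weylHeisenbergShift R k ∈ Set.Icc (-R) R := fun k ω hω => by
    rw [fourier_weylHeisenbergFilter] at hω
    exact mem_of_tsupport_subset hsupp hω
  have hk1 : ∀ k : {k : ℤ // k ≠ 0}, R ≤ (k.1.natAbs : ℝ) * R := fun k =>
    le_mul_of_one_le_left hR.le
      (by exact_mod_cast Nat.one_le_iff_ne_zero.2 (Int.natAbs_ne_zero.2 k.2))
  -- The support is `|k|R ≤ |ω| ≤ (|k|+2)R`. The centre `(5/3)|k|R` gives relative distance exactly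
  -- `2/3` at the lower edge, and less at the upper edge because `|k| ≥ 1`; hence `a = 3/2`.
  refine energy_succ_le_highPassEnergy hl (by norm_num) hR
    (fun k => memLp_one_iff_integrable.1 (memLp_weylHeisenbergFilter R h1 k))
    (fun k => memLp_weylHeisenbergFilter R h2 k) ?_ ?_
    (fun k => if 0 < k.1 then 5 / 3 * (k.1.natAbs * R) else -(5 / 3 * (k.1.natAbs * R))) ?_ N f
  · refine ae_tsum_ofReal_le_one hLP (fun _ _ => by positivity)
      (fun ω => by nlinarith [sq_nonneg ‖𝓕 φ ω‖]) (fun n ω => ?_) (fun n ω => ?_)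
      (fun k ω hk hω => ?_) (fun k ω hk hω => ?_)
    · rw [fourier_weylHeisenbergFilter, weylHeisenbergShift_posIndex]
    -- Negative indices carry the same window `g`, not a reflected one; evenness of `ĝ` makes them
    -- mirror images.
    · rw [fourier_weylHeisenbergFilter, weylHeisenbergShift_negIndex, ← heven]
      congr 3
      ring_nf
    · have h := hmem k ω fun h => hk (by simp [h])
      by_contra hk'
      rw [weylHeisenbergShift, if_neg hk'] at h
      nlinarith [h.2, hk1 k]
    · have h := hmem k ω fun h => hk (by simp [h])
      intro hk'
      rw [weylHeisenbergShift, if_pos hk'] at h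
      nlinarith [h.1, hk1 k]
  · intro k ω hω
    have h := hmem k ω hω
    have := hk1 k
    rw [le_abs]
    unfold weylHeisenbergShift at h
    split_ifs at h
    · left; linarith [h.1]
    · right; linarith [h.2]
  · intro k ω hω
    have h := hmem k ω hω
    have := hk1 k
    unfold weylHeisenbergShift at h
    obtain ⟨h3, h4⟩ := h
    split_ifs at h3 h4 ⊢
    · rw [abs_of_nonneg (by linarith : 0 ≤ ω), abs_le]
      constructor <;> linarith
    · rw [abs_of_nonpos (by linarith : ω ≤ 0), abs_le]
      constructor <;> linarith

/-- The Littlewood-Paley identity forces a positive bandwidth, by the Riemann-Lebesgue lemma. -/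
theorem bandwidth_pos {R : ℝ} {g φ : ℝ → ℂ} (hsupp : tsupport (𝓕 g) ⊆ Set.Icc (-R) R)
    (hLP : ∀ᵐ ω : ℝ, 0 ≤ ω →
      HasSum (fun k : ℕ => ‖𝓕 g (ω - R * (((k + 1 : ℕ) : ℝ) + 1))‖ ^ 2) (1 - ‖𝓕 φ ω‖ ^ 2)) :
    0 < R := by
  by_contra! hR
  have hlim := (Real.zero_at_infty_fourier φ).mono_left (atTop_le_cocompact (α := ℝ))
  obtain ⟨M, hM⟩ := Filter.eventually_atTop.1
    (hlim.norm.eventually (gt_mem_nhds (by simp : ‖(0 : ℂ)‖ < 1)))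
  have hnot : ∀ᵐ ω : ℝ, ω ∉ Set.Ioi (max M 0) := by
    filter_upwards [hLP] with ω hω hmem
    have hmem : max M 0 < ω := hmem
    have hω0 : 0 < ω := (le_max_right _ _).trans_lt hmem
    -- For `R ≤ 0 < ω` every argument is positive, hence outside the support; the identity then
    -- forces `|φ̂(ω)| = 1`, against the decay of `φ̂`.
    have hz : ∀ k : ℕ, ‖𝓕 g (ω - R * (((k + 1 : ℕ) : ℝ) + 1))‖ ^ 2 = 0 := fun k => by
      by_contra hne
      have h := mem_of_tsupport_subset hsupp (x := ω - R * (((k + 1 : ℕ) : ℝ) + 1))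
        fun h => hne (by rw [h]; simp)
      have : (0 : ℝ) ≤ ((k + 1 : ℕ) : ℝ) := Nat.cast_nonneg _
      nlinarith [h.2]
    have h0 := hω hω0.le
    simp_rw [hz] at h0
    have h1 := h0.unique hasSum_zero
    have h2 := hM ω ((le_max_left _ _).trans hmem.le)
    nlinarith [norm_nonneg (𝓕 φ ω)]
  have hv : volume (Set.Ioi (max M 0)) = 0 := measure_eq_zero_iff_ae_notMem.2 hnot
  rw [Real.volume_Ioi] at hv
  exact ENNReal.top_ne_zero hv

end Scattering

theorem theorem2 (l : ℝ) (hl : 1 < l) :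
    -- (i) wavelets
    (∀ ψ φ : ℝ → ℂ,
      MemLp ψ 1 volume → MemLp ψ 2 volume → MemLp φ 1 volume → MemLp φ 2 volume →
      tsupport (𝓕 ψ) ⊆ Set.Icc (1 / 2 : ℝ) 2 →
      (∀ᵐ ω : ℝ, 0 ≤ ω →
        HasSum (fun j : ℕ => ‖𝓕 ψ (ω / 2 ^ (j + 1))‖ ^ 2) (1 - ‖𝓕 φ ω‖ ^ 2)) →
      (∀ (f : Lp ℂ 2 (volume : Measure ℝ)) (N : ℕ), 1 ≤ N →
        Scattering.energy (Scattering.waveletFilter ψ) N f ≤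
          Scattering.highPassEnergy l ((5 / 3) ^ (N - 1)) f) ∧
      (∀ (s : ℝ), 0 < s → ∀ f : Lp ℂ 2 (volume : Measure ℝ), Scattering.MemSobolevSpace s f →
        ∃ C : ℝ, 0 < C ∧ ∃ N₀ : ℕ, ∀ N : ℕ, N₀ ≤ N →
          Scattering.energy (Scattering.waveletFilter ψ) N f ≤
            ENNReal.ofReal (C * (5 / 3 : ℝ) ^ (-(min 1 (2 * s) * (N : ℝ)))))) ∧
    -- (ii) Weyl-Heisenberg filters
    (∀ (R : ℝ) (g φ : ℝ → ℂ),
      MemLp g 1 volume → MemLp g 2 volume → MemLp φ 1 volume → MemLp φ 2 volume →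
      tsupport (𝓕 g) ⊆ Set.Icc (-R) R →
      (∀ ω : ℝ, 𝓕 g (-ω) = 𝓕 g ω) →
      (∀ᵐ ω : ℝ, 0 ≤ ω →
        HasSum (fun k : ℕ => ‖𝓕 g (ω - R * (((k + 1 : ℕ) : ℝ) + 1))‖ ^ 2)
          (1 - ‖𝓕 φ ω‖ ^ 2)) →
      (∀ (f : Lp ℂ 2 (volume : Measure ℝ)) (N : ℕ), 1 ≤ N →
        Scattering.energy (Scattering.weylHeisenbergFilter R g) N f ≤
          Scattering.highPassEnergy l ((3 / 2) ^ (N - 1) * R) f) ∧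
      (∀ (s : ℝ), 0 < s → ∀ f : Lp ℂ 2 (volume : Measure ℝ), Scattering.MemSobolevSpace s f →
        ∃ C : ℝ, 0 < C ∧ ∃ N₀ : ℕ, ∀ N : ℕ, N₀ ≤ N →
          Scattering.energy (Scattering.weylHeisenbergFilter R g) N f ≤
            ENNReal.ofReal (C * (3 / 2 : ℝ) ^ (-(min 1 (2 * s) * (N : ℝ)))))) := by
  refine ⟨fun ψ φ h1 h2 _ _ hsupp hLP => ?_, fun R g φ h1 h2 _ _ hsupp heven hLP => ?_⟩
  · have key : ∀ (f : Lp ℂ 2 (volume : Measure ℝ)) (N : ℕ), 1 ≤ N →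
        Scattering.energy (Scattering.waveletFilter ψ) N f ≤
          Scattering.highPassEnergy l ((5 / 3) ^ (N - 1) * 1) f := fun f N hN => by
      obtain ⟨M, rfl⟩ := Nat.exists_eq_add_of_le' hN
      exact Scattering.energy_waveletFilter_le hl h1 h2 hsupp hLP f M
    refine ⟨fun f N hN => by simpa only [mul_one] using key f N hN, fun s hs f hf => ?_⟩
    exact Scattering.exists_decay_of_memSobolevSpace hl (by norm_num) one_pos (key f) hs hf
  · have hR := Scattering.bandwidth_pos hsupp hLP
    have key : ∀ (f : Lp ℂ 2 (volume : Measure ℝ)) (N : ℕ), 1 ≤ N →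
        Scattering.energy (Scattering.weylHeisenbergFilter R g) N f ≤
          Scattering.highPassEnergy l ((3 / 2) ^ (N - 1) * R) f := fun f N hN => by
      obtain ⟨M, rfl⟩ := Nat.exists_eq_add_of_le' hN
      exact Scattering.energy_weylHeisenbergFilter_le hl hR h1 h2 hsupp heven hLP f M
    exact ⟨key, fun s hs f hf =>
      Scattering.exists_decay_of_memSobolevSpace hl (by norm_num) hR (key f) hs hf⟩
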